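/- All digraphs are finite oriented graphs with non-empty vertex set (no loops, at most one arc between any two vertices). For a digraph $D$, $N^+(v)$ and $N^-(v)$ are the sets of out- and in-neighbors of $v$, and $N^{++}(v)$ is the set of vertices at directed distance exactly $2$ from $v$. A vertex $v$ has the second neighborhood property (SNP) in $D$ if $|N^+(v)|\le |N^{++}(v)|$, and is a sink if $N^+(v)=\emptyset$. A missing edge is an unordered pair $xy$ of distinct non-adjacent vertices; a vertex is whole if it is incident to no missing edge. A missing edge $xy$ loses to a missing edge $ab$ if, for a suitable naming of the ends, $x\to a$, $b\notin N^+(x)\cup N^{++}(x)$, $y\to b$ and $a\notin N^+(y)\cup N^{++}(y)$. The dependency digraph $\Delta$ has the missing edges of $D$ as vertices and an arc from each missing edge to every missing edge it loses to. For a connected component $C$ of $\Delta$ (ignoring directions), $K(C)$ is the set of ends of the missing edges in $C$. The interval graph of $D$ has the connected components of $\Delta$ as vertices, two distinct components $C_1,C_2$ being adjacent if $K(C_1)\cap K(C_2)\ne\emptyset$; for a connected component $\xi$ of the interval graph, $K(\xi)=\bigcup_{C\in\xi}K(C)$. For a vertex $x$, $J(x)=\{x\}$ if $x$ is whole, and otherwise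 $J(x)=K(\xi)$ for the unique $\xi$ with $x\in K(\xi)$. A set $S$ of vertices is an interval of $D$ if $N^+(u)\setminus S=N^+(v)\setminus S$ and $N^-(u)\setminus S=N^-(v)\setminus S$ for all $u,v\in S$. The digraph $D$ is good if $K(\xi)$ is an interval of $D$ for every connected component $\xi$ of its interval graph. Theorem. Let $D$ be a good digraph. Suppose that for every vertex $x$ that is incident to a missing edge, $J(x)$ contains at least two vertices with the SNP in the induced subdigraph $D[J(x)]$. If $D$ has no sink, then $D$ has at least two vertices with the SNP. -/

import Mathlib

namespace SecondNeighborhood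

variable {V : Type*}

/-- An oriented graph: at most one arc between any two vertices. In particular (`u = v`)
there are no loops. -/
def IsOriented (D : Digraph V) : Prop :=
  ∀ u v, D.Adj u v → ¬ D.Adj v u

/-- The out-neighborhood `N⁺(v)`. -/
def outNbhd (D : Digraph V) (v : V) : Set V := {w | D.Adj v w}

/-- The in-neighborhood `N⁻(v)`. -/
def inNbhd (D : Digraph V) (v : V) : Set V := {w | D.Adj w v}

/-- The second out-neighborhood `N⁺⁺(v)`: the vertices at distance exactly two from `v`. -/
def secondOutNbhd (D : Digraph V) (v : V) : Set V :=
  {w | w ≠ v ∧ ¬ D.Adj v w ∧ ∃ u, D.Adj v u ∧ D.Adj u w}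

/-- The second neighborhood property (used for finite digraphs only). -/
def HasSNP (D : Digraph V) (v : V) : Prop :=
  (outNbhd D v).ncard ≤ (secondOutNbhd D v).ncard

/-- A sink: a vertex of out-degree `0`. -/
def IsSink (D : Digraph V) (v : V) : Prop := outNbhd D v = ∅

/-- The subdigraph `D[S]` induced by a set of vertices. -/
def induced (D : Digraph V) (S : Set V) : Digraph S where
  Adj u v := D.Adj u v

/-- The missing graph. It is taken on all of `V`; the whole vertices are its isolated vertices. -/
def missingGraph (D : Digraph V) : SimpleGraph V where
  Adj u v := u ≠ v ∧ ¬ D.Adj u v ∧ ¬ D.Adj v u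
  symm := ⟨fun _ _ h => ⟨h.1.symm, h.2.2, h.2.1⟩⟩
  loopless := ⟨fun _ h => h.1 rfl⟩

/-- A whole vertex: it is not incident to any missing edge. -/
def IsWhole (D : Digraph V) (v : V) : Prop := ∀ x, ¬ (missingGraph D).Adj v x

/-- The type of (unordered) missing edges of `D`. -/
abbrev MissingEdge (D : Digraph V) : Type _ := (missingGraph D).edgeSet

/-- The missing edge `e` loses to the missing edge `f`: for some naming `e = xy`, `f = ab` of the
ends, `x → a`, `b ∉ N⁺(x) ∪ N⁺⁺(x)`, `y → b` and `a ∉ N⁺(y) ∪ N⁺⁺(y)`. -/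
def Loses (D : Digraph V) (e f : MissingEdge D) : Prop :=
  ∃ x y a b : V, (e : Sym2 V) = s(x, y) ∧ (f : Sym2 V) = s(a, b) ∧
    D.Adj x a ∧ b ∉ outNbhd D x ∪ secondOutNbhd D x ∧
    D.Adj y b ∧ a ∉ outNbhd D y ∪ secondOutNbhd D y

/-- The dependency digraph `Δ(D)`. -/
def dependencyDigraph (D : Digraph V) : Digraph (MissingEdge D) where
  Adj := Loses D

/-- The connected components of `Δ(D)` (components of the underlying undirected graph). -/
abbrev DepComponent (D : Digraph V) : Type _ :=
  (dependencyDigraph D).toSimpleGraphInclusive.ConnectedComponent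

/-- `K(C)`: the ends of the missing edges in the component `C`. -/
def K (D : Digraph V) (C : DepComponent D) : Set V :=
  {u | ∃ e : MissingEdge D, e ∈ C.supp ∧ u ∈ (e : Sym2 V)}

/-- The interval graph of `D`. -/
def intervalGraph (D : Digraph V) : SimpleGraph (DepComponent D) where
  Adj C₁ C₂ := C₁ ≠ C₂ ∧ (K D C₁ ∩ K D C₂).Nonempty
  symm := ⟨fun _ _ h => ⟨h.1.symm, by rw [Set.inter_comm]; exact h.2⟩⟩
  loopless := ⟨fun _ h => h.1 rfl⟩

/-- `K(ξ)`, for a connected component `ξ` of the interval graph. -/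
def Kxi (D : Digraph V) (ξ : (intervalGraph D).ConnectedComponent) : Set V :=
  ⋃ C ∈ ξ.supp, K D C

/-- A non-whole vertex lies in `K(ξ)` for exactly one component `ξ` of the interval graph. -/
theorem existsUnique_mem_Kxi (D : Digraph V) (f : V) (hf : ¬ IsWhole D f) :
    ∃! ξ : (intervalGraph D).ConnectedComponent, f ∈ Kxi D ξ := by
  obtain ⟨x, hx⟩ : ∃ x, (missingGraph D).Adj f x := by
    simpa [IsWhole] using hf
  let e : MissingEdge D := ⟨s(f, x), hx⟩
  let C₀ : DepComponent D := (dependencyDigraph D).toSimpleGraphInclusive.connectedComponentMk e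
  have h₀ : f ∈ K D C₀ := ⟨e, rfl, by simp [e]⟩
  refine ⟨(intervalGraph D).connectedComponentMk C₀, ?_, ?_⟩
  · exact Set.mem_biUnion (x := C₀) rfl h₀
  · intro ξ hξ
    obtain ⟨C, hC, hfC⟩ := Set.mem_iUnion₂.1 hξ
    have hC' : (intervalGraph D).connectedComponentMk C = ξ := hC
    rw [← hC']
    by_cases h : C = C₀
    · rw [h]
    · exact SimpleGraph.ConnectedComponent.sound
        (SimpleGraph.Adj.reachable (G := intervalGraph D) ⟨h, f, hfC, h₀⟩)

open Classical in
/-- `J(f)`: it is `{f}` if `f` is whole, and otherwise `K(ξ)` for the unique component `ξ` of the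
interval graph with `f ∈ K(ξ)`. -/
noncomputable def J (D : Digraph V) (f : V) : Set V :=
  if hf : IsWhole D f then {f} else Kxi D (existsUnique_mem_Kxi D f hf).choose

/-- An interval (module) of `D`. -/
def IsInterval (D : Digraph V) (S : Set V) : Prop :=
  ∀ u ∈ S, ∀ v ∈ S,
    outNbhd D u \ S = outNbhd D v \ S ∧ inNbhd D u \ S = inNbhd D v \ S

/-- A good digraph: all the sets `K(ξ)` are intervals. -/
def IsGood (D : Digraph V) : Prop :=
  ∀ ξ : (intervalGraph D).ConnectedComponent, IsInterval D (Kxi D ξ)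

end SecondNeighborhood

/-! Contracting every class `J(x)` of a good digraph gives a tournament; weight each class by its
size. If a class satisfies the weighted form of the SNP, then every vertex with the SNP inside
`D[J(x)]` has it in `D` (`IsGood.hasSNP_of_induced`), since the class is an interval.

The last vertex of a weighted median order satisfies the weighted property
(`IsMedian.sedimentation`). If it is a class of non-whole vertices, the hypothesis on `J(x)`
supplies two vertices. Otherwise it is a whole vertex `f` of weight 1, which has an out-neighbor
because it is not a sink. A second class then comes from median orders of the tournament without
`f`, sedimented repeatedly until the last vertex makes up for a possible arc to `f`
(`exists_ne_firstWeight_le_secondWeight`). -/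

namespace WeightedTournament

open Classical in
/-- The weight of the out-neighbors of `a` in the list `l`. -/
noncomputable def outWeight {α : Type*} (r : α → α → Prop) (w : α → ℕ) (a : α) (l : List α) : ℕ :=
  (l.map fun x => if r a x then w x else 0).sum

open Classical in
/-- The weight of the in-neighbors of `a` in the list `l`. -/
noncomputable def inWeight {α : Type*} (r : α → α → Prop) (w : α → ℕ) (a : α) (l : List α) : ℕ :=
  (l.map fun x => if r x a then w x else 0).sum

/-- The total weight of the forward arcs from the list `l` to the list `m`. -/
noncomputable def crossWeight {α : Type*} (r : α → α → Prop) (w : α → ℕ) (l m : List α) : ℕ :=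
  (l.map fun a => w a * outWeight r w a m).sum

/-- The total weight of the forward arcs of an ordering. -/
noncomputable def score {α : Type*} (r : α → α → Prop) (w : α → ℕ) : List α → ℕ
  | [] => 0
  | a :: l => w a * outWeight r w a l + score r w l

/-- A weighted median order: it maximises the weight of the forward arcs. -/
def IsMedian {α : Type*} (r : α → α → Prop) (w : α → ℕ) (l : List α) : Prop :=
  ∀ m : List α, m.Perm l → score r w m ≤ score r w l

/-- The vertices reachable from `a` in one or two steps. -/
def Near {α : Type*} (r : α → α → Prop) (a x : α) : Prop := r a x ∨ ∃ y, r a y ∧ r y x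

open Classical in
/-- The total weight of the out-neighborhood. -/
noncomputable def firstWeight {α : Type*} [Fintype α] (r : α → α → Prop) (w : α → ℕ) (a : α) : ℕ :=
  ∑ x, if r a x then w x else 0

open Classical in
/-- The total weight of the second out-neighborhood. -/
noncomputable def secondWeight {α : Type*} [Fintype α] (r : α → α → Prop) (w : α → ℕ) (a : α) : ℕ :=
  ∑ x, if x ≠ a ∧ ¬ r a x ∧ ∃ y, r a y ∧ r y x then w x else 0

/-! ### Weighted median orders and sedimentation -/

section
variable {α : Type*} {r : α → α → Prop} {w : α → ℕ}

theorem outWeight_append (a : α) (l m : List α) :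
    outWeight r w a (l ++ m) = outWeight r w a l + outWeight r w a m := by
  simp [outWeight]

theorem inWeight_append (a : α) (l m : List α) :
    inWeight r w a (l ++ m) = inWeight r w a l + inWeight r w a m := by
  simp [inWeight]

theorem outWeight_perm (a : α) {l m : List α} (h : l.Perm m) :
    outWeight r w a l = outWeight r w a m :=
  (h.map _).sum_eq

theorem crossWeight_perm {l l' m m' : List α} (h : l.Perm l') (h' : m.Perm m') :
    crossWeight r w l m = crossWeight r w l' m' := by
  unfold crossWeight
  simp only [fun a => outWeight_perm (r := r) (w := w) a h']
  exact (h.map _).sum_eq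

theorem score_cons (a : α) (l : List α) :
    score r w (a :: l) = w a * outWeight r w a l + score r w l := rfl

theorem score_append (l m : List α) :
    score r w (l ++ m) = score r w l + score r w m + crossWeight r w l m := by
  induction l with
  | nil => simp [score, crossWeight]
  | cons a l ih =>
    simp only [List.cons_append, score, ih, outWeight_append, crossWeight, List.map_cons,
      List.sum_cons]
    ring

theorem crossWeight_singleton (p : List α) (b : α) :
    crossWeight r w p [b] = w b * inWeight r w b p := by
  induction p with
  | nil => simp [crossWeight, inWeight]
  | cons a p ih =>
    have ih' : (p.map fun a => w a * outWeight r w a [b]).sum = w b * inWeight r w b p := ih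
    simp only [crossWeight, List.map_cons, List.sum_cons, ih']
    simp only [outWeight, inWeight, List.map_cons, List.sum_cons, List.map_nil, List.sum_nil]
    split_ifs <;> ring

theorem score_concat (p : List α) (b : α) :
    score r w (p ++ [b]) = score r w p + w b * inWeight r w b p := by
  rw [score_append, crossWeight_singleton]
  simp [score, outWeight]

/-- Rearranging one block leaves the cross term with the other block unchanged. -/
theorem IsMedian.of_append_left {l m : List α} (h : IsMedian r w (l ++ m)) : IsMedian r w l := by
  intro l' hl
  have := h (l' ++ m) (hl.append_right m)
  rw [score_append, score_append, crossWeight_perm hl (List.Perm.refl m)] at this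
  omega

theorem IsMedian.of_append_right {l m : List α} (h : IsMedian r w (l ++ m)) : IsMedian r w m := by
  intro m' hm
  have := h (l ++ m') (hm.append_left l)
  rw [score_append, score_append, crossWeight_perm (List.Perm.refl l) hm] at this
  omega

theorem IsMedian.of_score_eq {l m : List α} (h : IsMedian r w l) (hp : m.Perm l)
    (hs : score r w m = score r w l) : IsMedian r w m :=
  fun m' hm => hs ▸ h m' (hm.trans hp)

theorem IsMedian.score_eq {l m : List α} (h : IsMedian r w l) (h' : IsMedian r w m)
    (hp : m.Perm l) : score r w m = score r w l :=
  le_antisymm (h m hp) (h' l hp.symm)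

/-- Otherwise moving `b` to the front would increase the score. -/
theorem IsMedian.outWeight_le_inWeight (hw : ∀ a, 0 < w a) {p : List α} {b : α}
    (h : IsMedian r w (p ++ [b])) : outWeight r w b p ≤ inWeight r w b p := by
  have := h (b :: p) (List.perm_append_singleton b p).symm
  rw [score_concat, score] at this
  exact Nat.le_of_mul_le_mul_left (by omega) (hw b)

theorem IsMedian.rotate {p q : List α} {b : α} (h : IsMedian r w (p ++ b :: q))
    (he : outWeight r w b p = inWeight r w b p) : IsMedian r w (b :: (p ++ q)) := by
  have hp : (b :: p).Perm (p ++ [b]) := (List.perm_append_singleton b p).symm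
  have h1 : p ++ b :: q = (p ++ [b]) ++ q := by simp
  rw [h1] at h
  refine h.of_score_eq (m := (b :: p) ++ q) (hp.append_right q) ?_
  rw [score_append, score_append (p ++ [b]), crossWeight_perm hp (List.Perm.refl q), score_concat,
    score, he, add_comm (w b * _)]

theorem sum_map_le {l : List α} {g h : α → ℕ} (H : ∀ x ∈ l, g x ≤ h x) :
    (l.map g).sum ≤ (l.map h).sum := List.sum_le_sum H

open Classical in
/-- Sedimentation of a median order: the vertices at distance at least three from the last
vertex `f` go to the front, followed by `f`. -/
theorem IsMedian.sedimentation (hasymm : ∀ a b, r a b → ¬ r b a)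
    (htotal : ∀ a b, a ≠ b → r a b ∨ r b a) (hw : ∀ a, 0 < w a) (f : α) (n : ℕ) :
    ∀ l : List α, l.length = n → f ∉ l → IsMedian r w (l ++ [f]) →
      outWeight r w f (l.filter fun x => Near r f x) ≤
        inWeight r w f (l.filter fun x => Near r f x) ∧
      (outWeight r w f (l.filter fun x => Near r f x) =
        inWeight r w f (l.filter fun x => Near r f x) →
        IsMedian r w ((l.filter fun x => ¬ Near r f x) ++ f :: l.filter fun x => Near r f x)) := by
  induction n using Nat.strong_induction_on with
  | _ n ih =>
  intro l hl hf hmed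
  by_cases hall : ∀ x ∈ l, Near r f x
  · have h1 : (l.filter fun x => Near r f x) = l := by simpa using hall
    have h2 : (l.filter fun x => ¬ Near r f x) = [] := by simpa using hall
    rw [h1, h2]
    refine ⟨hmed.outWeight_le_inWeight hw, fun he => ?_⟩
    simpa using IsMedian.rotate (q := []) hmed he
  obtain ⟨b, p, q, hlpq, hb, hpn⟩ :
      ∃ b p q, l = p ++ b :: q ∧ ¬ Near r f b ∧ ∀ x ∈ p, Near r f x := by
    push Not at hall
    obtain ⟨b, hb⟩ : ∃ b, l.find? (fun x => ¬ Near r f x) = some b := by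
      rw [← Option.isSome_iff_exists, List.find?_isSome]
      simpa using hall
    obtain ⟨hb, p, q, h, h'⟩ := List.find?_eq_some_iff_append.1 hb
    exact ⟨b, p, q, h, by simpa using hb, by simpa using h'⟩
  subst hlpq
  have hfp : f ∉ p := fun h => hf (by simp [h])
  have hfq : f ∉ q := fun h => hf (by simp [h])
  -- Since `b` is not reached from `f` within two steps, it dominates all out-neighbors of `f`.
  -- Hence, on `p`, out(`f`) ≤ out(`b`) ≤ in(`b`) ≤ in(`f`).
  have hbout : ∀ y, r f y → r b y := fun y hy =>
    (htotal b y (fun e => hb (Or.inl (e ▸ hy)))).resolve_right fun h => hb (Or.inr ⟨y, hy, h⟩)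
  have hp1 : (p.filter fun x => Near r f x) = p := by simpa using hpn
  have hp2 : (p.filter fun x => ¬ Near r f x) = [] := by simpa using hpn
  have c1 : outWeight r w f p ≤ outWeight r w b p := by
    refine sum_map_le fun x _ => ?_
    by_cases h : r f x
    · simp [h, hbout x h]
    · simp [h]
  have c2 : outWeight r w b p ≤ inWeight r w b p := by
    refine IsMedian.outWeight_le_inWeight hw (IsMedian.of_append_left (m := q ++ [f]) ?_)
    simpa using hmed
  have c3 : inWeight r w b p ≤ inWeight r w f p := by
    refine sum_map_le fun x hx => ?_
    by_cases h : r x b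
    · have : r x f := (htotal x f (fun e => hfp (e ▸ hx))).resolve_right
        fun h' => hasymm _ _ h (hbout x h')
      simp [h, this]
    · simp [h]
  have e1 : ((p ++ b :: q).filter fun x => Near r f x) = p ++ q.filter fun x => Near r f x := by
    rw [List.filter_append, hp1, List.filter_cons_of_neg (by simpa using hb)]
  have e2 : ((p ++ b :: q).filter fun x => ¬ Near r f x) = b :: q.filter fun x => ¬ Near r f x := by
    rw [List.filter_append, hp2, List.filter_cons_of_pos (by simpa using hb), List.nil_append]
  rw [e1, e2]
  -- A strict middle inequality gives a surplus on `p`, and the bound on `q` preserves it, so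
  -- equality cannot occur.
  by_cases hlt : outWeight r w b p < inWeight r w b p
  · have := (ih q.length (by simp at hl; omega) q rfl hfq
      (IsMedian.of_append_right (l := p ++ [b]) (by simpa using hmed))).1
    simp only [outWeight_append, inWeight_append]
    exact ⟨by omega, fun h => by omega⟩
  -- Under equality `b` may go to the front without losing score; induction sediments the remaining
  -- order behind it.
  · have hrot : IsMedian r w (b :: (p ++ (q ++ [f]))) :=
      IsMedian.rotate (by simpa using hmed) (by omega)
    have hmed' : IsMedian r w ((p ++ q) ++ [f]) :=
      IsMedian.of_append_right (l := [b]) (by simpa using hrot)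
    have := ih (p ++ q).length (by simp at hl ⊢; omega) (p ++ q) rfl (by simp [hfp, hfq]) hmed'
    rw [List.filter_append, List.filter_append, hp1, hp2, List.nil_append] at this
    refine ⟨this.1, fun he => ?_⟩
    have hm := this.2 he
    have hperm : ((q.filter fun x => ¬ Near r f x) ++ f :: (p ++ q.filter fun x => Near r f x)).Perm
        (p ++ (q ++ [f])) := by
      classical
      rw [List.perm_iff_count]
      intro a
      have hq := ((List.filter_append_perm (fun x => decide (Near r f x)) q).count_eq a)
      simp only [List.count_append, List.count_cons, List.count_nil, decide_not] at hq ⊢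
      omega
    refine hrot.of_score_eq (hperm.cons b) ?_
    rw [List.cons_append, score_cons, score_cons, outWeight_perm b hperm, IsMedian.score_eq (by simpa using hmed') hm hperm]

theorem exists_isMedian (l : List α) : ∃ m : List α, m.Perm l ∧ IsMedian r w m := by
  classical
  obtain ⟨m, hm, hmax⟩ := l.permutations.toFinset.exists_max_image (score r w)
    ⟨l, by simp⟩
  simp only [List.mem_toFinset, List.mem_permutations] at hm hmax
  exact ⟨m, hm, fun m' h => hmax m' (h.trans hm)⟩

-- By asymmetry an in-neighbor of `f` is never an out-neighbor, so if it is near `f` it is at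
-- distance exactly two.
open Classical in
theorem inWeight_filter_le_secondWeight [Fintype α] (hasymm : ∀ a b, r a b → ¬ r b a) {l : List α} {f : α}
    (hl : l.Nodup) : inWeight r w f (l.filter fun x => Near r f x) ≤ secondWeight r w f := by
  have hn : (l.filter fun x => Near r f x).Nodup := hl.filter _
  unfold inWeight secondWeight
  rw [← List.sum_toFinset _ hn]
  refine (Finset.sum_le_sum fun x hx => ?_).trans
    (Finset.sum_le_sum_of_subset (Finset.subset_univ _))
  by_cases h : r x f
  · have h1 : ¬ r f x := hasymm _ _ h
    have h2 : Near r f x := by simpa using (List.mem_filter.1 (List.mem_toFinset.1 hx)).2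
    have h3 : x ≠ f := by rintro rfl; exact h1 h
    simp [h, h1, h3, h2.resolve_left h1]
  · simp [h]

open Classical in
theorem outWeight_filter (f : α) (l : List α) :
    outWeight r w f (l.filter fun x => Near r f x) = outWeight r w f l := by
  induction l with
  | nil => rfl
  | cons a l ih =>
    by_cases h : Near r f a
    · rw [List.filter_cons_of_pos (by simpa using h)]
      simp only [outWeight, List.map_cons, List.sum_cons] at ih ⊢
      rw [ih]
    · rw [List.filter_cons_of_neg (by simpa using h), ih]
      have : ¬ r f a := fun h' => h (Or.inl h')
      simp [outWeight, this]

open Classical in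
theorem outWeight_eq_sum (f : α) {l : List α} (S : Finset α) (hl : l.Perm S.toList) :
    outWeight r w f l = ∑ x ∈ S, if r f x then w x else 0 := by
  rw [outWeight_perm f hl, outWeight, Finset.sum_map_toList]

/-! ### Vertices with the weighted second neighborhood property -/

theorem exists_firstWeight_le_secondWeight [Fintype α] [Nonempty α] (hasymm : ∀ a b, r a b → ¬ r b a)
    (htotal : ∀ a b, a ≠ b → r a b ∨ r b a) (hw : ∀ a, 0 < w a) :
    ∃ f, firstWeight r w f ≤ secondWeight r w f := by
  classical
  obtain ⟨m, hm, hmed⟩ := exists_isMedian (r := r) (w := w) (Finset.univ : Finset α).toList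
  have hnd : m.Nodup := hm.nodup_iff.2 (Finset.nodup_toList _)
  obtain rfl | ⟨l, f, rfl⟩ := List.eq_nil_or_concat' m
  · obtain ⟨a⟩ := ‹Nonempty α›
    have : a ∈ ([] : List α) := hm.mem_iff.2 (by simp)
    simp at this
  have hf : f ∉ l := by simpa using (List.nodup_append_comm.1 hnd).notMem
  refine ⟨f, ?_⟩
  have h := (hmed.sedimentation hasymm htotal hw f _ l rfl hf).1
  rw [outWeight_filter] at h
  have h1 := outWeight_eq_sum (r := r) (w := w) f _ hm
  have h2 : outWeight r w f (l ++ [f]) = outWeight r w f l := by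
    simpa [outWeight_append, outWeight] using fun h => absurd h (hasymm f f h)
  rw [firstWeight, ← h1, h2]
  exact h.trans (inWeight_filter_le_secondWeight hasymm hnd.of_append_left)

/-- Median orders are taken on the vertices other than `f`, while `Near` and both weights refer to
the whole tournament. An arc from the last vertex to `f` costs just `w f = 1`. -/
theorem exists_ne_firstWeight_le_secondWeight [Fintype α] (hasymm : ∀ a b, r a b → ¬ r b a)
    (htotal : ∀ a b, a ≠ b → r a b ∨ r b a) (hw : ∀ a, 0 < w a) {f v : α} (hwf : w f = 1)
    (hfv : r f v) : ∃ y, y ≠ f ∧ firstWeight r w y ≤ secondWeight r w y := by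
  classical
  -- Induction on the number `n` of vertices after `v` in the order.
  have key : ∀ (n : ℕ) (a c : List α), c.length = n → IsMedian r w (a ++ v :: c) →
      (a ++ v :: c).Perm (Finset.univ.erase f).toList →
      ∃ y, y ≠ f ∧ firstWeight r w y ≤ secondWeight r w y := by
    intro n
    induction n using Nat.strong_induction_on with
    | _ n ih =>
    intro a c hc hmed hperm
    obtain ⟨l, y, hly⟩ : ∃ l y, a ++ v :: c = l ++ [y] := by
      obtain h | h := List.eq_nil_or_concat' (a ++ v :: c)
      · simp at h
      · exact h
    have hnd : (l ++ [y]).Nodup := hly ▸ hperm.nodup_iff.2 (Finset.nodup_toList _)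
    have hy : y ∉ l := by simpa using (List.nodup_append_comm.1 hnd).notMem
    have hyf : y ≠ f := by
      have : y ∈ a ++ v :: c := by simp [hly]
      simpa using hperm.mem_iff.1 this
    have hsed := (hly ▸ hmed).sedimentation hasymm htotal hw y _ l rfl hy
    rw [outWeight_filter] at hsed
    have hsec := inWeight_filter_le_secondWeight (w := w) (f := y) hasymm hnd.of_append_left
    have hout : firstWeight r w y = (if r y f then 1 else 0) + outWeight r w y l := by
      have h2 : outWeight r w y (l ++ [y]) = outWeight r w y l := by
        simpa [outWeight_append, outWeight] using fun h => absurd h (hasymm y y h)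
      rw [← h2, outWeight_eq_sum y _ (hly ▸ hperm), firstWeight,
        ← Finset.add_sum_erase _ _ (Finset.mem_univ f), hwf]
    by_cases hyf' : r y f
    swap
    · exact ⟨y, hyf, by rw [hout, if_neg hyf']; omega⟩
    rw [if_pos hyf'] at hout
    -- A strict inequality of naturals absorbs the extra 1 from `f`; equality permits sedimentation.
    obtain hlt | heq := lt_or_eq_of_le hsed.1
    · exact ⟨y, hyf, by omega⟩
    have hyv : y ≠ v := by rintro rfl; exact hasymm _ _ hfv hyf'
    -- The path through `f` keeps `v` behind `y` after sedimentation, so fewer vertices follow `v`.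
    have hnear : Near r y v := Or.inr ⟨f, hyf', hfv⟩
    obtain rfl | ⟨c', z, rfl⟩ := List.eq_nil_or_concat' c
    · have := List.append_inj_right' hly rfl
      simp at this
      exact absurd this.symm hyv
    have h3 : (a ++ v :: c') ++ [z] = l ++ [y] := by simpa using hly
    obtain rfl : z = y := by simpa using List.append_inj_right' h3 rfl
    obtain rfl : a ++ v :: c' = l := List.append_inj_left' h3 rfl
    have hR : ((a ++ v :: c').filter fun x => Near r z x) =
        (a.filter fun x => Near r z x) ++ v :: c'.filter fun x => Near r z x := by
      rw [List.filter_append, List.filter_cons_of_pos (by simpa using hnear)]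
    have hm := hsed.2 heq
    have hp : (((a ++ v :: c').filter fun x => ¬ Near r z x) ++
        z :: (a ++ v :: c').filter fun x => Near r z x).Perm (a ++ v :: c' ++ [z]) := by
      rw [List.perm_iff_count]
      intro x
      have hq := ((List.filter_append_perm (fun x => decide (Near r z x)) (a ++ v :: c')).count_eq x)
      rw [List.count_append] at hq ⊢
      rw [List.count_append (l₂ := [z]), List.count_cons, ← hq]
      simp only [List.count_cons, List.count_nil, decide_not]
      omega
    have hp' := hp.trans (h3 ▸ hly ▸ hperm)
    rw [hR] at hm hp'
    refine ih (c'.filter fun x => Near r z x).length ?_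
      (((a ++ v :: c').filter fun x => ¬ Near r z x) ++ z :: a.filter fun x => Near r z x) _ rfl
      (by simpa using hm) (by simpa using hp')
    have := List.length_filter_le (fun x => decide (Near r z x)) c'
    simp at hc
    omega
  obtain ⟨m, hm, hmed⟩ := exists_isMedian (r := r) (w := w) (Finset.univ.erase f).toList
  have hvm : v ∈ m := hm.mem_iff.2 (by
    simp only [Finset.mem_toList, Finset.mem_erase, Finset.mem_univ, and_true]
    rintro rfl
    exact hasymm _ _ hfv hfv)
  obtain ⟨a, c, rfl⟩ := List.append_of_mem hvm
  exact key _ a c rfl hmed hm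

end

end WeightedTournament

/-! ### The quotient tournament of the classes `J(x)` -/

namespace SecondNeighborhood

section
variable {V : Type*} {D : Digraph V}

theorem J_of_isWhole {x : V} (h : IsWhole D x) : J D x = {x} := by
  rw [J, dif_pos h]

theorem J_eq_Kxi {x : V} {ξ : (intervalGraph D).ConnectedComponent} (hx : x ∈ Kxi D ξ)
    (h : ¬ IsWhole D x) : J D x = Kxi D ξ := by
  rw [J, dif_neg h, (existsUnique_mem_Kxi D x h).unique
    (existsUnique_mem_Kxi D x h).choose_spec.1 hx]

theorem not_isWhole_of_mem_Kxi {x : V} {ξ : (intervalGraph D).ConnectedComponent}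
    (hx : x ∈ Kxi D ξ) : ¬ IsWhole D x := by
  obtain ⟨C, -, ⟨e, he⟩, -, hxe⟩ := Set.mem_iUnion₂.1 hx
  obtain ⟨y, rfl⟩ := Sym2.mem_iff_exists.1 hxe
  exact fun h => h y he

theorem exists_J_eq_Kxi {x : V} (h : ¬ IsWhole D x) : ∃ ξ, x ∈ Kxi D ξ ∧ J D x = Kxi D ξ := by
  obtain ⟨ξ, hξ, -⟩ := existsUnique_mem_Kxi D x h
  exact ⟨ξ, hξ, J_eq_Kxi hξ h⟩

theorem mem_J_self (x : V) : x ∈ J D x := by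
  by_cases h : IsWhole D x
  · simp [J_of_isWhole h]
  · obtain ⟨ξ, h1, h2⟩ := exists_J_eq_Kxi h
    rwa [h2]

theorem J_eq_of_mem {x y : V} (hy : y ∈ J D x) : J D y = J D x := by
  by_cases h : IsWhole D x
  · rw [J_of_isWhole h] at hy
    rw [Set.mem_singleton_iff.1 hy]
  · obtain ⟨ξ, h1, h2⟩ := exists_J_eq_Kxi h
    rw [h2] at hy ⊢
    exact J_eq_Kxi hy (not_isWhole_of_mem_Kxi hy)

theorem mem_J_iff {x y : V} : y ∈ J D x ↔ J D y = J D x :=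
  ⟨J_eq_of_mem, fun h => h ▸ mem_J_self y⟩

theorem IsGood.isInterval_J (h : IsGood D) (x : V) : IsInterval D (J D x) := by
  by_cases hx : IsWhole D x
  · rw [J_of_isWhole hx]
    rintro u rfl v rfl
    exact ⟨rfl, rfl⟩
  · obtain ⟨ξ, -, h2⟩ := exists_J_eq_Kxi hx
    rw [h2]
    exact h ξ

/-- Both ends of a missing edge lie in the same `K(C)`, hence in the same class. -/
theorem adj_or_adj_of_J_ne {x y : V} (h : J D x ≠ J D y) : D.Adj x y ∨ D.Adj y x := by
  by_contra hc
  push Not at hc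
  have hxy : (missingGraph D).Adj x y := ⟨fun e => h (e ▸ rfl), hc.1, hc.2⟩
  let e : MissingEdge D := ⟨s(x, y), hxy⟩
  let C : DepComponent D := (dependencyDigraph D).toSimpleGraphInclusive.connectedComponentMk e
  have hmem : ∀ z ∈ s(x, y), z ∈ Kxi D ((intervalGraph D).connectedComponentMk C) := fun z hz =>
    Set.mem_biUnion (x := C) rfl ⟨e, rfl, hz⟩
  have hx := hmem x (by simp)
  have hy := hmem y (by simp)
  exact h ((J_eq_Kxi hx (not_isWhole_of_mem_Kxi hx)).trans
    (J_eq_Kxi hy (not_isWhole_of_mem_Kxi hy)).symm)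

theorem IsGood.adj_congr (h : IsGood D) {x x' y y' : V} (hx : J D x' = J D x)
    (hy : J D y' = J D y) (hxy : J D x ≠ J D y) (ha : D.Adj x y) : D.Adj x' y' := by
  have h1 : D.Adj x' y := by
    have := (h.isInterval_J x x (mem_J_self x) x' (mem_J_iff.2 hx)).1
    have hy' : y ∈ outNbhd D x \ J D x := ⟨ha, fun hm => hxy (J_eq_of_mem hm).symm⟩
    rw [this] at hy'
    exact hy'.1
  have := (h.isInterval_J y y (mem_J_self y) y' (mem_J_iff.2 hy)).2
  have hx' : x' ∈ inNbhd D y \ J D y := ⟨h1, fun hm => hxy (hx.symm.trans (J_eq_of_mem hm))⟩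
  rw [this] at hx'
  exact hx'.1

/-- The quotient tournament of the classes `J(x)`. -/
def ClassAdj (D : Digraph V) (A B : Set.range (J D)) : Prop :=
  A ≠ B ∧ ∃ a b, J D a = A ∧ J D b = B ∧ D.Adj a b

/-- The class `J(x)` as a vertex of the quotient tournament. -/
def toClass (D : Digraph V) (x : V) : Set.range (J D) := ⟨J D x, x, rfl⟩

theorem toClass_eq_iff {x y : V} : toClass D x = toClass D y ↔ J D x = J D y :=
  Subtype.ext_iff

theorem IsGood.classAdj_iff (h : IsGood D) {x y : V} :
    ClassAdj D (toClass D x) (toClass D y) ↔ J D x ≠ J D y ∧ D.Adj x y := by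
  rw [ClassAdj, Ne, toClass_eq_iff]
  refine and_congr_right fun hne => ⟨?_, fun ha => ⟨x, y, rfl, rfl, ha⟩⟩
  rintro ⟨a, b, ha, hb, hab⟩
  simp only [toClass] at ha hb
  exact h.adj_congr ha.symm hb.symm (by rwa [ha, hb]) hab

theorem exists_toClass_eq (A : Set.range (J D)) : ∃ x, toClass D x = A := by
  obtain ⟨_, x, rfl⟩ := A
  exact ⟨x, rfl⟩

theorem sum_ncard_classes [Finite V] [Fintype (Set.range (J D))] (P : Set.range (J D) → Prop)
    [DecidablePred P] :
    ∑ A, (if P A then (A : Set V).ncard else 0) = {v | P (toClass D v)}.ncard := by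
  classical
  have := Fintype.ofFinite V
  rw [← Finset.sum_filter, Set.ncard_eq_toFinset_card',
    Finset.card_eq_sum_card_fiberwise (f := toClass D) (t := Finset.univ.filter P)
      (fun v hv => by simpa using hv)]
  refine Finset.sum_congr rfl fun A hA => ?_
  obtain ⟨x, rfl⟩ := exists_toClass_eq A
  rw [← Set.ncard_coe_finset]
  congr 1
  ext v
  have hP : P (toClass D x) := by simpa using hA
  rw [show (toClass D x : Set V) = J D x from rfl, mem_J_iff, ← toClass_eq_iff]
  simp only [Finset.mem_coe, Finset.mem_filter, Set.mem_toFinset, Set.mem_ofPred_eq, iff_and_self]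
  exact fun hv => hv ▸ hP

theorem ncard_outNbhd_induced (S : Set V) (v : S) :
    (outNbhd (induced D S) v).ncard = (outNbhd D v ∩ S).ncard := by
  rw [← Set.ncard_image_of_injective _ Subtype.val_injective]
  congr 1
  ext x
  simp [outNbhd, induced, and_comm]

theorem ncard_secondOutNbhd_induced_le [Finite V] (S : Set V) (v : S) :
    (secondOutNbhd (induced D S) v).ncard ≤ (secondOutNbhd D v ∩ S).ncard := by
  rw [← Set.ncard_image_of_injective _ Subtype.val_injective]
  refine Set.ncard_le_ncard ?_ (Set.toFinite _)
  rintro _ ⟨x, ⟨h1, h2, u, h3, h4⟩, rfl⟩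
  exact ⟨⟨fun h => h1 (Subtype.ext h), h2, u, h3, h4⟩, x.2⟩

/-- Split both neighborhoods of `v` along `J D x`. Inside, the induced SNP applies; outside, the
out-neighborhood is a union of classes counted by `firstWeight`, and the second one contains those
counted by `secondWeight`. -/
theorem IsGood.hasSNP_of_induced [Finite V] [Fintype (Set.range (J D))] (hgood : IsGood D)
    {x : V} (hx : WeightedTournament.firstWeight (ClassAdj D) (fun A => (A : Set V).ncard)
        (toClass D x) ≤
      WeightedTournament.secondWeight (ClassAdj D) (fun A => (A : Set V).ncard) (toClass D x))
    (v : J D x) (hv : HasSNP (induced D (J D x)) v) : HasSNP D (v : V) := by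
  obtain ⟨v, hvJ⟩ := v
  have hJv : J D v = J D x := J_eq_of_mem hvJ
  have hc : toClass D x = toClass D v := toClass_eq_iff.2 hJv.symm
  unfold WeightedTournament.firstWeight WeightedTournament.secondWeight at hx
  rw [sum_ncard_classes, sum_ncard_classes, hc] at hx
  have h1 : {u | ClassAdj D (toClass D v) (toClass D u)} = outNbhd D v \ J D x := by
    ext u
    simp only [Set.mem_ofPred_eq, hgood.classAdj_iff, Set.mem_sdiff, mem_J_iff, outNbhd, hJv]
    exact ⟨fun h => ⟨h.2, h.1.symm⟩, fun h => ⟨Ne.symm h.2, h.1⟩⟩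
  have h2 : {u | toClass D u ≠ toClass D v ∧ ¬ ClassAdj D (toClass D v) (toClass D u) ∧
      ∃ y, ClassAdj D (toClass D v) y ∧ ClassAdj D y (toClass D u)} ⊆
      secondOutNbhd D v \ J D x := by
    rintro u ⟨h1, h2, A, h3, h4⟩
    obtain ⟨z, rfl⟩ := exists_toClass_eq A
    rw [hgood.classAdj_iff] at h2 h3 h4
    rw [Ne, toClass_eq_iff] at h1
    exact ⟨⟨fun e => h1 (e ▸ rfl), fun ha => h2 ⟨Ne.symm h1, ha⟩, z, h3.2, h4.2⟩,
      fun hm => h1 ((J_eq_of_mem hm).trans hJv.symm)⟩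
  rw [h1] at hx
  have h3 := Set.ncard_le_ncard h2 (Set.toFinite _)
  have h4 := ncard_secondOutNbhd_induced_le (D := D) (J D x) ⟨v, hvJ⟩
  have h5 := ncard_outNbhd_induced (D := D) (J D x) ⟨v, hvJ⟩
  have h6 := Set.ncard_inter_add_ncard_sdiff_eq_ncard (outNbhd D v) (J D x) (Set.toFinite _)
  have h7 := Set.ncard_inter_add_ncard_sdiff_eq_ncard (secondOutNbhd D v) (J D x) (Set.toFinite _)
  unfold HasSNP at hv ⊢
  simp only at h4 h5 ⊢
  omega

end

end SecondNeighborhood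

/-! ### Lifting the classes back to two vertices of `D` -/

open SecondNeighborhood WeightedTournament in
theorem theoremt {V : Type*} [Finite V] [Nonempty V] (D : Digraph V)
    (hD : SecondNeighborhood.IsOriented D)
    (hgood : SecondNeighborhood.IsGood D)
    (hJ : ∀ x : V, ¬ SecondNeighborhood.IsWhole D x →
      2 ≤ {v : SecondNeighborhood.J D x | SecondNeighborhood.HasSNP
        (SecondNeighborhood.induced D (SecondNeighborhood.J D x)) v}.ncard)
    (hsink : ∀ v : V, ¬ SecondNeighborhood.IsSink D v) :
    2 ≤ {v : V | SecondNeighborhood.HasSNP D v}.ncard := by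
  have := Fintype.ofFinite (Set.range (J D))
  have hne : Nonempty (Set.range (J D)) := ‹Nonempty V›.map (toClass D)
  have hasymm : ∀ A B, ClassAdj D A B → ¬ ClassAdj D B A := by
    intro A B
    obtain ⟨x, rfl⟩ := exists_toClass_eq A
    obtain ⟨y, rfl⟩ := exists_toClass_eq B
    rw [hgood.classAdj_iff, hgood.classAdj_iff]
    exact fun h h' => hD _ _ h.2 h'.2
  have htotal : ∀ A B, A ≠ B → ClassAdj D A B ∨ ClassAdj D B A := by
    intro A B
    obtain ⟨x, rfl⟩ := exists_toClass_eq A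
    obtain ⟨y, rfl⟩ := exists_toClass_eq B
    rw [hgood.classAdj_iff, hgood.classAdj_iff, Ne, toClass_eq_iff]
    exact fun h => (adj_or_adj_of_J_ne h).imp (fun h' => ⟨h, h'⟩) fun h' => ⟨Ne.symm h, h'⟩
  have hw : ∀ A : Set.range (J D), 0 < (A : Set V).ncard := by
    intro A
    obtain ⟨x, rfl⟩ := exists_toClass_eq A
    exact (Set.ncard_pos (Set.toFinite _)).2 ⟨x, mem_J_self x⟩
  have of_not_whole : ∀ x, ¬ IsWhole D x →
      firstWeight (ClassAdj D) (fun A => (A : Set V).ncard) (toClass D x) ≤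
        secondWeight (ClassAdj D) (fun A => (A : Set V).ncard) (toClass D x) →
      2 ≤ {v : V | HasSNP D v}.ncard := by
    intro x hx hle
    refine (hJ x hx).trans ?_
    rw [← Set.ncard_image_of_injective _ Subtype.val_injective]
    refine Set.ncard_le_ncard ?_ (Set.toFinite _)
    rintro _ ⟨v, hv, rfl⟩
    exact hgood.hasSNP_of_induced hle v hv
  have of_whole : ∀ x, IsWhole D x →
      firstWeight (ClassAdj D) (fun A => (A : Set V).ncard) (toClass D x) ≤
        secondWeight (ClassAdj D) (fun A => (A : Set V).ncard) (toClass D x) → HasSNP D x := by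
    intro x hx hle
    refine hgood.hasSNP_of_induced hle ⟨x, mem_J_self x⟩ ?_
    have : outNbhd (induced D (J D x)) ⟨x, mem_J_self x⟩ = ∅ := by
      ext ⟨y, hy⟩
      rw [J_of_isWhole hx] at hy
      obtain rfl := Set.mem_singleton_iff.1 hy
      simpa [outNbhd, induced] using fun h => hD _ _ h h
    rw [HasSNP, this, Set.ncard_empty]
    exact Nat.zero_le _
  obtain ⟨A, hA⟩ := exists_firstWeight_le_secondWeight hasymm htotal hw
  obtain ⟨f, rfl⟩ := exists_toClass_eq A
  by_cases hf : IsWhole D f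
  swap
  · exact of_not_whole f hf hA
  obtain ⟨v, hv⟩ : ∃ v, D.Adj f v := Set.nonempty_iff_ne_empty.2 (hsink f)
  have hfv : J D f ≠ J D v := by
    intro e
    have hm : v ∈ J D f := mem_J_iff.2 e.symm
    rw [J_of_isWhole hf] at hm
    obtain rfl := Set.mem_singleton_iff.1 hm
    exact hD _ _ hv hv
  -- The class of the whole vertex `f` is `{f}`, so its weight is 1.
  obtain ⟨B, hB, hle⟩ := exists_ne_firstWeight_le_secondWeight hasymm htotal hw
    (f := toClass D f) (by simp [toClass, J_of_isWhole hf]) (hgood.classAdj_iff.2 ⟨hfv, hv⟩)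
  obtain ⟨y, rfl⟩ := exists_toClass_eq B
  by_cases hy : IsWhole D y
  swap
  · exact of_not_whole y hy hle
  have hyf : y ≠ f := fun e => hB (e ▸ rfl)
  rw [← Set.ncard_pair hyf]
  refine Set.ncard_le_ncard ?_ (Set.toFinite _)
  rintro z (rfl | rfl)
  · exact of_whole _ hy hle
  · exact of_whole _ hf hA
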